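/- Let $\mathbb{C}[t]=\mathbb{C}[t_1,t_2,\dots]$ be the polynomial ring in infinitely many variables, let $\mathbb{C}[Q]=\bigoplus_{n\in\mathbb{Z}}\mathbb{C}e^{n\alpha}$ be the group algebra of $Q=\mathbb{Z}\alpha$, and let $V=\mathbb{C}[t]\otimes\mathbb{C}[Q]$; write $P e^{n\alpha}$ for $P\otimes e^{n\alpha}$. Put $$\eta(t,z)=\sum_{j\ge1}t_jz^j,\qquad \eta(\tilde\partial_t,z^{-1})=\sum_{j\ge1}\frac1j\frac{\partial}{\partial t_j}z^{-j},$$ and $e^{\pm\alpha}(Pe^{n\alpha})=Pe^{(n\pm1)\alpha}$, $z^{\pm H}(Pe^{n\alpha})=z^{\pm2n}Pe^{n\alpha}$. In the homogeneous vertex-operator realization of the basic representation of the affine Lie algebra of type $A_1^{(1)}$ on $V$, the elements $E_m=E\otimes t^m$ and $F_m=F\otimes t^m$ $(m\in\mathbb{Z})$ act as the coefficients of $E(z)=\sum_m E_mz^{-m-1}$ and $F(z)=\sum_m F_mz^{-m-1}$, where $$E(z)=e^{\eta(t,z)}e^{-2\eta(\tilde\partial_t,z^{-1})}e^{\alpha}z^{H},\qquad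 F(z)=e^{-\eta(t,z)}e^{2\eta(\tilde\partial_t,z^{-1})}e^{-\alpha}z^{-H}.$$ All $E_m$ and $F_m$ are locally nilpotent on $V$, so $\exp(cE_m)$ and $\exp(cF_m)$ are defined for $c\in\mathbb{C}$. Let $G\subset GL(V)$ be the group generated by all of these exponentials $(c\in\mathbb{C},\ m\in\mathbb{Z})$. A $\tau$-function of the NLS-Toda hierarchy is a non-zero vector in the orbit $G\cdot(1\otimes e^0)$. Write $F=F_0$. Define polynomials $p_r(t)$ by $e^{\eta(t,z)}=\sum_{r\ge0}p_r(t)z^r$ and $p_r=0$ for $r<0$. For $\lambda=(\lambda_1,\dots,\lambda_l)$ let $S_\lambda(t)=\det\bigl(p_{\lambda_i-i+j}(t)\bigr)_{1\le i,j\le l}$ be the Schur function (equal to $1$ for $l=0$), and let $\square(a,b)=(b,\dots,b)$ with $b$ repeated $a$ times. **Theorem.** Let $k\ge0$ be an integer and $\gamma\in\mathbb{C}$. Then $\exp(\gamma F)(e^{k\alpha})$ is a $\tau$-function of the NLS-Toda hierarchy, and $$\exp(\gamma F)(e^{k\alpha})=\sum_{n=0}^{2k}(-1)^{\frac{n(n+1)}2}\gamma^n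 S_{\square(2k-n,n)}(t)\,e^{(k-n)\alpha}.$$ Moreover, $F^ne^{k\alpha}=n!\,(-1)^{\frac{n(n+1)}2}S_{\square(2k-n,n)}(t)\,e^{(k-n)\alpha}$ for $0\le n\le 2k$, and $F^ne^{k\alpha}=0$ for $n>2k$. -/

import Mathlib

open scoped TensorProduct Nat

noncomputable section

namespace NLSToda

/-- The polynomial ring `ℂ[t] = ℂ[t₁, t₂, …]`. -/
abbrev Poly : Type := MvPolynomial ℕ+ ℂ

/-- The group algebra `ℂ[Q]` of the root lattice `Q = ℤα`, with `nα` written as `n : ℤ`. -/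
abbrev LatticeAlg : Type := AddMonoidAlgebra ℂ ℤ

/-- The space `V = ℂ[t] ⊗ ℂ[Q]`. -/
abbrev V : Type := Poly ⊗[ℂ] LatticeAlg

/-- The vector `P e^{nα} = P ⊗ e^{nα}` of `V`. -/
def vec (P : Poly) (n : ℤ) : V := P ⊗ₜ[ℂ] (AddMonoidAlgebra.single n (1 : ℂ))

/-! ### Formal exponentials of power series -/

/-- The exponential `∑ fⁿ / n!` of a formal power series `f` **without constant term** over a
`ℂ`-algebra `A` which need not be commutative.  As `fⁿ` has order at least `n`, the coefficient of
index `m` only involves the terms with `n ≤ m`. -/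
def formalExp {A : Type} [Ring A] [Algebra ℂ A] (f : PowerSeries A) : PowerSeries A :=
  PowerSeries.mk fun m =>
    ∑ n ∈ Finset.range (m + 1), ((n ! : ℂ)⁻¹) • PowerSeries.coeff m (f ^ n)

/-- The coefficient of index `r : ℤ` of a power series, zero for `r < 0`. -/
def intCoeff {A : Type} [Ring A] (f : PowerSeries A) (r : ℤ) : A :=
  if 0 ≤ r then PowerSeries.coeff r.toNat f else 0

/-- `η(t, z) = ∑_{j ≥ 1} t_j z^j`. -/
def eta : PowerSeries Poly :=
  PowerSeries.mk fun j => if h : 0 < j then MvPolynomial.X (j.toPNat h) else 0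

/-- The operator `∂/∂t_j` on `ℂ[t]`. -/
def partialT (j : ℕ+) : Module.End ℂ Poly := (MvPolynomial.pderiv j).toLinearMap

/-- `η(∂̃_t, w) = ∑_{j ≥ 1} (1/j) (∂/∂t_j) w^j`, with operators on `ℂ[t]` as coefficients. -/
def etaDer : PowerSeries (Module.End ℂ Poly) :=
  PowerSeries.mk fun j =>
    if h : 0 < j then ((j : ℂ)⁻¹) • partialT (j.toPNat h) else 0

/-! ### Schur functions -/

/-- The polynomials `p_r(t)`, where `e^{η(t,z)} = ∑ p_r(t) z^r` and `p_r = 0` for `r < 0`. -/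
def p (r : ℤ) : Poly := intCoeff (formalExp eta) r

/-- The Schur function `S_λ(t) = det (p_{λ_i - i + j}(t))` of `λ = (λ_1, …, λ_n)`. -/
def schur {n : ℕ} (lam : Fin n → ℕ) : Poly :=
  (Matrix.of fun i j : Fin n => p ((lam i : ℤ) - (i : ℤ) + (j : ℤ))).det

/-- The Schur function of the rectangle `□(a, b) = (b, …, b)` (`a` times). -/
def schurRect (a b : ℕ) : Poly := schur fun _ : Fin a => b

/-! ### Pointwise finite sums and exponentials of locally nilpotent operators -/

/-- The sum of a sequence of operators of which only finitely many act non-trivially on any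
given vector. -/
def locFinSum {M N : Type} [AddCommGroup M] [Module ℂ M] [AddCommGroup N] [Module ℂ N]
    (f : ℕ → M →ₗ[ℂ] N) (hf : ∀ v, ∃ B, ∀ i, B ≤ i → f i v = 0) : M →ₗ[ℂ] N where
  toFun v := ∑ᶠ i, f i v
  map_add' u v := by
    have fin : ∀ w, (Function.support fun i => f i w).Finite := fun w => by
      obtain ⟨B, hB⟩ := hf w
      refine (Set.finite_lt_nat B).subset fun i hi => ?_
      by_contra h
      exact hi (hB i (not_lt.mp h))
    simp only [map_add]
    exact finsum_add_distrib (fin u) (fin v)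
  map_smul' c v := by
    simp only [map_smul, RingHom.id_apply]
    exact (smul_finsum c _).symm

/-- Every vector is annihilated by some power of `X`. -/
def IsLocallyNilpotent {M : Type} [AddCommGroup M] [Module ℂ M] (X : Module.End ℂ M) : Prop :=
  ∀ v, ∃ B : ℕ, (X ^ B) v = 0

/-- The exponential `exp X = ∑ Xⁿ / n!` of a locally nilpotent operator `X`. -/
def opExp {M : Type} [AddCommGroup M] [Module ℂ M] (X : Module.End ℂ M)
    (hX : IsLocallyNilpotent X) : Module.End ℂ M :=
  locFinSum (fun n => ((n ! : ℂ)⁻¹) • X ^ n) fun v => by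
    obtain ⟨B, hB⟩ := hX v
    refine ⟨B, fun i hi => ?_⟩
    obtain ⟨d, rfl⟩ := Nat.exists_eq_add_of_le' hi
    simp [pow_add, hB]

theorem IsLocallyNilpotent.smul {M : Type} [AddCommGroup M] [Module ℂ M] {X : Module.End ℂ M}
    (hX : IsLocallyNilpotent X) (c : ℂ) : IsLocallyNilpotent (c • X) := fun v => by
  obtain ⟨B, hB⟩ := hX v
  exact ⟨B, by simp [smul_pow, hB]⟩

/-! ### The degree filtration of `ℂ[t]`, `deg t_j = j` -/

/-- The degree of a monomial. -/
def wt (μ : ℕ+ →₀ ℕ) : ℤ := μ.sum fun j e => (e : ℤ) * (j : ℕ)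

theorem wt_add (μ ν : ℕ+ →₀ ℕ) : wt (μ + ν) = wt μ + wt ν := by
  unfold wt
  rw [Finsupp.sum_add_index'] <;> intros <;> simp [add_mul]

theorem wt_single (j : ℕ+) (e : ℕ) : wt (Finsupp.single j e) = (e : ℤ) * (j : ℕ) := by
  simp [wt]

theorem wt_nonneg (μ : ℕ+ →₀ ℕ) : 0 ≤ wt μ :=
  Finset.sum_nonneg fun _ _ => by positivity

/-- The polynomials of degree at most `d`. -/
def degLE (d : ℤ) : Submodule ℂ Poly where
  carrier := {P | ∀ μ, MvPolynomial.coeff μ P ≠ 0 → wt μ ≤ d}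
  add_mem' {P Q} hP hQ μ h := by
    by_cases h1 : MvPolynomial.coeff μ P = 0
    · exact hQ μ fun h2 => h (by simp [h1, h2])
    · exact hP μ h1
  zero_mem' μ h := absurd (MvPolynomial.coeff_zero μ) h
  smul_mem' c P hP μ h := hP μ fun h1 => h (by simp [h1])

theorem degLE_mono {d d' : ℤ} (h : d ≤ d') {P : Poly} (hP : P ∈ degLE d) : P ∈ degLE d' :=
  fun μ hμ => (hP μ hμ).trans h

theorem eq_zero_of_degLE {d : ℤ} (hd : d < 0) {P : Poly} (hP : P ∈ degLE d) : P = 0 := by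
  ext μ
  by_contra h
  have := hP μ h
  have := wt_nonneg μ
  omega

theorem exists_degLE (P : Poly) : ∃ d : ℕ, P ∈ degLE d := by
  refine ⟨(∑ μ ∈ P.support, wt μ).toNat, fun μ hμ => ?_⟩
  have h := Finset.single_le_sum (f := wt) (fun ν _ => wt_nonneg ν)
    (MvPolynomial.mem_support_iff.mpr hμ)
  exact h.trans (Int.self_le_toNat _)

theorem degLE_mul {d d' : ℤ} {P Q : Poly} (hP : P ∈ degLE d) (hQ : Q ∈ degLE d') :
    P * Q ∈ degLE (d + d') := by
  intro μ hμ
  rw [MvPolynomial.coeff_mul] at hμ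
  obtain ⟨x, hx, hne⟩ := Finset.exists_ne_zero_of_sum_ne_zero hμ
  rw [Finset.HasAntidiagonal.mem_antidiagonal] at hx
  rw [← hx, wt_add]
  exact add_le_add (hP _ (left_ne_zero_of_mul hne)) (hQ _ (right_ne_zero_of_mul hne))

theorem one_mem_degLE : (1 : Poly) ∈ degLE 0 := by
  intro μ hμ
  rw [MvPolynomial.coeff_one] at hμ
  have : μ = 0 := by
    by_contra h
    exact hμ (if_neg (Ne.symm h))
  simp [this, wt]

theorem X_mem_degLE (j : ℕ+) : (MvPolynomial.X j : Poly) ∈ degLE (j : ℕ) := by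
  intro μ hμ
  rw [MvPolynomial.coeff_X] at hμ
  have : Finsupp.single j 1 = μ := by
    by_contra h
    exact hμ (if_neg h)
  simp [← this, wt_single]

theorem pderiv_mem_degLE (j : ℕ+) {d : ℤ} {P : Poly} (hP : P ∈ degLE d) :
    MvPolynomial.pderiv j P ∈ degLE (d - (j : ℕ)) := by
  intro μ hμ
  rw [MvPolynomial.coeff_pderiv] at hμ
  have := hP _ (left_ne_zero_of_mul hμ)
  rw [wt_add, wt_single] at this
  simp at this
  omega

theorem coeff_pow_mem (c : ℂ) (n r : ℕ) :
    PowerSeries.coeff r ((c • eta) ^ n) ∈ degLE r := by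
  induction n generalizing r with
  | zero =>
    rw [pow_zero, PowerSeries.coeff_one]
    split_ifs
    · exact degLE_mono (by omega) one_mem_degLE
    · exact zero_mem _
  | succ n ih =>
    rw [pow_succ, PowerSeries.coeff_mul]
    refine Submodule.sum_mem _ fun x hx => ?_
    rw [Finset.HasAntidiagonal.mem_antidiagonal] at hx
    rw [← hx, Nat.cast_add]
    refine degLE_mul (ih _) ?_
    rw [PowerSeries.coeff_smul]
    refine Submodule.smul_mem _ _ ?_
    rw [eta, PowerSeries.coeff_mk]
    split_ifs
    · exact X_mem_degLE _
    · exact zero_mem _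

theorem formalExp_eta_mem (c : ℂ) (r : ℕ) :
    PowerSeries.coeff r (formalExp (c • eta)) ∈ degLE r := by
  rw [formalExp, PowerSeries.coeff_mk]
  exact Submodule.sum_mem _ fun n _ => Submodule.smul_mem _ _ (coeff_pow_mem c n r)

theorem coeff_pow_der_mem (c : ℂ) (n r : ℕ) {d : ℤ} {P : Poly} (hP : P ∈ degLE d) :
    PowerSeries.coeff r ((c • etaDer) ^ n) P ∈ degLE (d - r) := by
  induction n generalizing r d P with
  | zero =>
    rw [pow_zero, PowerSeries.coeff_one]
    split_ifs with h
    · simpa [h] using hP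
    · exact zero_mem _
  | succ n ih =>
    rw [pow_succ, PowerSeries.coeff_mul, LinearMap.sum_apply]
    refine Submodule.sum_mem _ fun x hx => ?_
    rw [Finset.HasAntidiagonal.mem_antidiagonal] at hx
    have hd : d - (r : ℤ) = d - (x.2 : ℤ) - (x.1 : ℤ) := by omega
    rw [hd, Module.End.mul_apply]
    refine ih _ ?_
    rw [PowerSeries.coeff_smul, LinearMap.smul_apply]
    refine Submodule.smul_mem _ _ ?_
    rw [etaDer, PowerSeries.coeff_mk]
    split_ifs with h
    · rw [LinearMap.smul_apply]
      exact Submodule.smul_mem _ _ (pderiv_mem_degLE (x.2.toPNat h) hP)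
    · exact zero_mem _

theorem formalExp_etaDer_mem (c : ℂ) (r : ℕ) {d : ℤ} {P : Poly} (hP : P ∈ degLE d) :
    PowerSeries.coeff r (formalExp (c • etaDer)) P ∈ degLE (d - r) := by
  rw [formalExp, PowerSeries.coeff_mk, LinearMap.sum_apply]
  exact Submodule.sum_mem _ fun n _ => Submodule.smul_mem _ _ (coeff_pow_der_mem c n r hP)

/-! ### Vertex operators -/

/-- The coefficient of `z^s` in the operator `e^{εη(t,z)} e^{-2εη(∂̃_t,z⁻¹)}` on `ℂ[t]`: the sum
over all `i` of the product of the coefficient of `z^{s+i}` in `e^{εη(t,z)}` and the coefficient of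
`z^{-i}` in `e^{-2εη(∂̃_t,z⁻¹)}`. -/
def polyMode (ε s : ℤ) : Module.End ℂ Poly :=
  locFinSum
    (fun i : ℕ =>
      LinearMap.mulLeft ℂ (intCoeff (formalExp ((ε : ℂ) • eta)) (s + i)) ∘ₗ
        PowerSeries.coeff i (formalExp ((-2 * (ε : ℂ)) • etaDer)))
    fun P => by
      obtain ⟨d, hd⟩ := exists_degLE P
      refine ⟨d + 1, fun i hi => ?_⟩
      have h : PowerSeries.coeff i (formalExp ((-2 * (ε : ℂ)) • etaDer)) P = 0 :=
        eq_zero_of_degLE (d := (d : ℤ) - i) (by omega) (formalExp_etaDer_mem _ i hd)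
      rw [LinearMap.comp_apply, h, map_zero]

/-- The mode of index `m`, i.e. the coefficient of `z^{-m-1}`, of the vertex operator
`e^{εη(t,z)} e^{-2εη(∂̃_t,z⁻¹)} e^{εα} z^{εH}` on `V`.  Since `z^{εH}` multiplies `P e^{nα}` by
`z^{2εn}`, it maps `P e^{nα}` to `P' e^{(n+ε)α}`, where `P'` is obtained from `P` by the coefficient
of `z^{-m-1-2εn}` in `e^{εη(t,z)} e^{-2εη(∂̃_t,z⁻¹)}`. -/
def vertexMode (ε m : ℤ) : Module.End ℂ V :=
  TensorProduct.lift <| LinearMap.flip <|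
    (Finsupp.lsum ℂ fun n : ℤ =>
      LinearMap.toSpanSingleton ℂ (Poly →ₗ[ℂ] V)
        ((TensorProduct.mk ℂ Poly LatticeAlg).flip (AddMonoidAlgebra.single (n + ε) 1) ∘ₗ
          polyMode ε (-m - 1 - 2 * ε * n))) ∘ₗ
    (AddMonoidAlgebra.coeffLinearEquiv ℂ).toLinearMap

theorem vertexMode_vec (ε m : ℤ) (P : Poly) (n : ℤ) :
    vertexMode ε m (vec P n) = vec (polyMode ε (-m - 1 - 2 * ε * n) P) (n + ε) := by
  simp only [vertexMode, vec, TensorProduct.lift.tmul, LinearMap.flip_apply, LinearMap.comp_apply]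
  erw [Finsupp.lsum_single]
  simp

/-- The action of `E_m = E ⊗ t^m` on `V`. -/
def E (m : ℤ) : Module.End ℂ V := vertexMode 1 m

/-- The action of `F_m = F ⊗ t^m` on `V`; `F = F_0`. -/
def F (m : ℤ) : Module.End ℂ V := vertexMode (-1) m

/-! ### Integrability -/

theorem polyMode_mem (ε s : ℤ) {d : ℤ} {P : Poly} (hP : P ∈ degLE d) :
    polyMode ε s P ∈ degLE (d + s) := by
  change (∑ᶠ i : ℕ, _) ∈ degLE (d + s)
  refine finsum_induction (p := fun Q => Q ∈ degLE (d + s)) (zero_mem _)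
    (fun _ _ => add_mem) fun i => ?_
  rw [LinearMap.comp_apply, LinearMap.mulLeft_apply, intCoeff]
  split_ifs with h
  · have h1 := formalExp_eta_mem (ε : ℂ) (s + i).toNat
    rw [Int.toNat_of_nonneg h] at h1
    have hd : d + s = (s + i) + (d - i) := by omega
    rw [hd]
    exact degLE_mul h1 (formalExp_etaDer_mem _ i hP)
  · rw [zero_mul]
    exact zero_mem _

theorem vertexMode_pow (ε m n : ℤ) {d : ℤ} {P : Poly} (hP : P ∈ degLE d) (N : ℕ) :
    ∃ Q ∈ degLE (d + N * (-m - 1 - 2 * ε * n) - ε * ε * (N * (N - 1))),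
      (vertexMode ε m ^ N) (vec P n) = vec Q (n + N * ε) := by
  induction N with
  | zero => exact ⟨P, by simpa using hP, by simp⟩
  | succ N ih =>
    obtain ⟨Q, hQ, h⟩ := ih
    refine ⟨polyMode ε (-m - 1 - 2 * ε * (n + N * ε)) Q, ?_, ?_⟩
    rotate_left
    · rw [pow_succ', Module.End.mul_apply, h, vertexMode_vec]
      congr 1
      push_cast
      ring
    · have h1 := polyMode_mem ε (-m - 1 - 2 * ε * (n + N * ε)) hQ
      refine degLE_mono (le_of_eq ?_) h1
      push_cast
      ring

theorem vertexMode_locNilp {ε : ℤ} (hε : ε * ε = 1) (m : ℤ) :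
    IsLocallyNilpotent (vertexMode ε m) := by
  have ext : ∀ (v : V) (A B : ℕ), A ≤ B → (vertexMode ε m ^ A) v = 0 →
      (vertexMode ε m ^ B) v = 0 := fun v A B hAB h => by
    obtain ⟨c, rfl⟩ := Nat.exists_eq_add_of_le' hAB
    rw [pow_add, Module.End.mul_apply, h, map_zero]
  have key : ∀ (P : Poly) (n : ℤ), ∃ B : ℕ, (vertexMode ε m ^ B) (vec P n) = 0 := by
    intro P n
    obtain ⟨d, hd⟩ := exists_degLE P
    set a : ℤ := -m - 1 - 2 * ε * n with ha
    refine ⟨d + a.natAbs + 2, ?_⟩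
    obtain ⟨Q, hQ, h⟩ := vertexMode_pow ε m n hd (d + a.natAbs + 2)
    rw [h, eq_zero_of_degLE (P := Q) ?_ hQ]
    · simp [vec]
    · rw [hε, ← ha]
      push_cast
      have h1 : a ≤ |a| := le_abs_self a
      have h2 : 0 ≤ |a| := abs_nonneg a
      have h3 : (0 : ℤ) ≤ d := by positivity
      nlinarith [mul_nonneg h3 h2]
  intro v
  induction v using TensorProduct.induction_on with
  | zero => exact ⟨0, by simp⟩
  | add x y hx hy =>
    obtain ⟨A, hA⟩ := hx
    obtain ⟨B, hB⟩ := hy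
    refine ⟨max A B, ?_⟩
    rw [map_add, ext x A _ (le_max_left _ _) hA, ext y B _ (le_max_right _ _) hB, add_zero]
  | tmul P q =>
    induction q using AddMonoidAlgebra.induction_linear with
    | zero => exact ⟨0, by simp⟩
    | add f g hf hg =>
      obtain ⟨A, hA⟩ := hf
      obtain ⟨B, hB⟩ := hg
      refine ⟨max A B, ?_⟩
      rw [TensorProduct.tmul_add, map_add, ext _ A _ (le_max_left _ _) hA,
        ext _ B _ (le_max_right _ _) hB, add_zero]
    | single n c =>
      obtain ⟨B, hB⟩ := key P n
      refine ⟨B, ?_⟩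
      have : P ⊗ₜ[ℂ] (AddMonoidAlgebra.single n c : LatticeAlg) = c • vec P n := by
        rw [vec, ← TensorProduct.tmul_smul, AddMonoidAlgebra.smul_single, smul_eq_mul, mul_one]
      rw [this, map_smul, hB, smul_zero]

theorem E_locNilp (m : ℤ) : IsLocallyNilpotent (E m) := vertexMode_locNilp (by norm_num) m

theorem F_locNilp (m : ℤ) : IsLocallyNilpotent (F m) := vertexMode_locNilp (by norm_num) m

/-- `exp (c E_m)`. -/
def expE (c : ℂ) (m : ℤ) : Module.End ℂ V := opExp (c • E m) ((E_locNilp m).smul c)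

/-- `exp (c F_m)`. -/
def expF (c : ℂ) (m : ℤ) : Module.End ℂ V := opExp (c • F m) ((F_locNilp m).smul c)

/-! ### τ-functions -/

/-- The group `G ⊆ GL(V)` generated by the operators `exp (c E_m)` and `exp (c F_m)`, for `c ∈ ℂ`
and `m ∈ ℤ`. -/
def G : Subgroup (LinearMap.GeneralLinearGroup ℂ V) :=
  Subgroup.closure {g | ∃ (c : ℂ) (m : ℤ),
    (g : Module.End ℂ V) = expE c m ∨ (g : Module.End ℂ V) = expF c m}

/-- A τ-function of the NLS-Toda hierarchy: a non-zero vector in the `G`-orbit of the highest weight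
vector `1 ⊗ e⁰`. -/
def IsTauFunction (τ : V) : Prop :=
  τ ≠ 0 ∧ ∃ g ∈ G, (g : Module.End ℂ V) (vec 1 0) = τ

end NLSToda

end

noncomputable section

namespace NLSToda

/-! ### Derivations and the formal exponential -/

section FormalExp

/-! The operator `exp(2η(∂̃_t, w))` is the Taylor shift `t_j ↦ t_j + 2w^j/j`, hence multiplicative
(`shiftMode_mul`), and it multiplies `e^{-η(t,z)}` by `exp(-2 ∑ (wz)^j/j) = (1 - wz)²`
(`shiftMode_pNeg`). Moving the annihilation parts to the right in `F(z_1)⋯F(z_n) e^{kα}` therefore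
produces the square of the Vandermonde determinant times `∏ z_i^{-2k} e^{-η(t,z_i)}`. So `F^n
e^{kα}` is the coefficient of `∏ z_i^{2k-1}` in `Δ(z)² ∏ e^{-η(t,z_i)}`; the map `umbral` extracts
this coefficient, and `polyMode_umbral` adds one variable at a time.

Expanding both Vandermonde factors gives `n!` times the Hankel determinant of the `p_{2k-1-i-j}(-t)`
(`umbral_vanDet_sq`). If `n > 2k`, its last row is zero. Otherwise `e^{η(t,z)} e^{-η(t,z)} = 1`
makes the Toeplitz matrices of `p_r(t)` and `p_r(-t)` inverse to each other, and the dual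
Jacobi–Trudi argument (`det_pNeg_eq`) turns the Hankel determinant into a signed rectangular Schur
function. Dividing by `n!` and summing gives the exponential.

For the orbit statement, an `sl₂` pair moves `e^{nα}` to `e^{(n+1)α}` inside `G` (`expF_expE_vec`),
and elements of `G` are invertible, so no vector of the orbit vanishes. -/

theorem coeff_pow_eq_zero_of_lt {A : Type} [Ring A] {f : PowerSeries A} (hf : PowerSeries.coeff 0 f = 0) {m n : ℕ}
    (h : m < n) : PowerSeries.coeff m (f ^ n) = 0 := by
  induction n generalizing m with
  | zero => omega
  | succ n ih =>
    rw [pow_succ, PowerSeries.coeff_mul]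
    refine Finset.sum_eq_zero fun x hx => ?_
    rw [Finset.HasAntidiagonal.mem_antidiagonal] at hx
    rcases Nat.eq_zero_or_pos x.2 with h0 | h0
    · rw [h0, hf, mul_zero]
    · rw [ih (by omega), zero_mul]

variable {A : Type} [Ring A] [Algebra ℂ A]

/-- Terms beyond the order bound vanish, so all coefficients occurring in a product can share one
cutoff. -/
theorem coeff_formalExp_of_lt {f : PowerSeries A} (hf : PowerSeries.coeff 0 f = 0) {m B : ℕ}
    (h : m < B) : PowerSeries.coeff m (formalExp f) =
      ∑ n ∈ Finset.range B, ((n ! : ℂ)⁻¹) • PowerSeries.coeff m (f ^ n) := by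
  rw [formalExp, PowerSeries.coeff_mk]
  refine Finset.sum_subset (Finset.range_subset_range.mpr h) fun n _ hn => ?_
  rw [Finset.mem_range] at hn
  rw [coeff_pow_eq_zero_of_lt hf (by omega), smul_zero]

@[simp]
theorem coeff_zero_formalExp (f : PowerSeries A) : PowerSeries.coeff 0 (formalExp f) = 1 := by
  simp [formalExp]

variable {d : ℕ → A →ₗ[ℂ] A}

/-- Letting `d` depend on the degree covers two cases at once: the Euler operator, `d m = m • id`,
and a derivation of the coefficients, constant in `m`. Since `A` may be an operator algebra, `f` has
to commute with its derivative. -/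
theorem leibniz_coeff_pow (hd : ∀ i j a b, d (i + j) (a * b) = d i a * b + a * d j b)
    {f g : PowerSeries A} (hg : ∀ m, PowerSeries.coeff m g = d m (PowerSeries.coeff m f))
    (comm : Commute f g) (n m : ℕ) :
    d m (PowerSeries.coeff m (f ^ (n + 1))) =
      ((n + 1 : ℕ) : ℂ) • PowerSeries.coeff m (f ^ n * g) := by
  induction n generalizing m with
  | zero => simp [hg]
  | succ n ih =>
    have h1 : d m (PowerSeries.coeff m (f ^ (n + 1) * f)) =
        PowerSeries.coeff m ((((n + 1 : ℕ) : ℂ) • (f ^ n * g)) * f + f ^ (n + 1) * g) := by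
      rw [PowerSeries.coeff_mul, map_sum, map_add, PowerSeries.coeff_mul, PowerSeries.coeff_mul,
        ← Finset.sum_add_distrib]
      refine Finset.sum_congr rfl fun x hx => ?_
      rw [Finset.HasAntidiagonal.mem_antidiagonal] at hx
      rw [← hx, hd, ih, hg, PowerSeries.coeff_smul]
    have h2 : (f ^ n * g) * f = f ^ (n + 1) * g := by
      rw [mul_assoc, ← comm.eq, ← mul_assoc, pow_succ]
    rw [pow_succ, h1, smul_mul_assoc, h2, map_add, PowerSeries.coeff_smul]
    push_cast
    module

theorem leibniz_one (hd : ∀ i j a b, d (i + j) (a * b) = d i a * b + a * d j b) :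
    d 0 (1 : A) = 0 := by
  have := hd 0 0 1 1
  simpa using this

/-- `δ (exp f) = exp f * δ f` for a coefficientwise derivation `δ`. -/
theorem leibniz_formalExp (hd : ∀ i j a b, d (i + j) (a * b) = d i a * b + a * d j b)
    {f g : PowerSeries A} (hf : PowerSeries.coeff 0 f = 0)
    (hg : ∀ m, PowerSeries.coeff m g = d m (PowerSeries.coeff m f))
    (comm : Commute f g) (m : ℕ) :
    d m (PowerSeries.coeff m (formalExp f)) = PowerSeries.coeff m (formalExp f * g) := by
  have h0 : d m (PowerSeries.coeff m (1 : PowerSeries A)) = 0 := by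
    rw [PowerSeries.coeff_one]
    split_ifs with h
    · rw [h, leibniz_one hd]
    · exact map_zero _
  -- One extra term is kept: once the constant term `n = 0` is dropped, `m + 1` terms remain,
  -- matching the cutoff used for the right-hand side.
  rw [coeff_formalExp_of_lt hf (show m < m + 1 + 1 by omega), Finset.sum_range_succ', map_add,
    pow_zero, map_smul, h0, smul_zero, add_zero, map_sum, PowerSeries.coeff_mul]
  have h1 : ∀ x ∈ Finset.HasAntidiagonal.antidiagonal m,
      PowerSeries.coeff x.1 (formalExp f) * PowerSeries.coeff x.2 g =
      ∑ n ∈ Finset.range (m + 1), ((n ! : ℂ)⁻¹) •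
        (PowerSeries.coeff x.1 (f ^ n) * PowerSeries.coeff x.2 g) := fun x hx => by
    rw [Finset.HasAntidiagonal.mem_antidiagonal] at hx
    rw [coeff_formalExp_of_lt hf (show x.1 < m + 1 by omega), Finset.sum_mul]
    simp only [smul_mul_assoc]
  rw [Finset.sum_congr rfl h1, Finset.sum_comm]
  refine Finset.sum_congr rfl fun n _ => ?_
  rw [map_smul, leibniz_coeff_pow hd hg comm, ← Finset.smul_sum, ← PowerSeries.coeff_mul,
    smul_smul]
  congr 1
  rw [Nat.factorial_succ]
  have : ((n + 1 : ℕ) : ℂ) ≠ 0 := Nat.cast_ne_zero.mpr n.succ_ne_zero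
  push_cast at this ⊢
  field_simp

/-- The Euler derivation `w d/dw` on power series. -/
def euler (f : PowerSeries A) : PowerSeries A :=
  PowerSeries.mk fun m => (m : ℂ) • PowerSeries.coeff m f

theorem coeff_euler (f : PowerSeries A) (m : ℕ) :
    PowerSeries.coeff m (euler f) = (m : ℂ) • PowerSeries.coeff m f := PowerSeries.coeff_mk _ _

theorem euler_mul (f g : PowerSeries A) : euler (f * g) = euler f * g + f * euler g := by
  ext m
  rw [coeff_euler, map_add]
  simp only [PowerSeries.coeff_mul, coeff_euler]
  rw [Finset.smul_sum, ← Finset.sum_add_distrib]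
  refine Finset.sum_congr rfl fun x hx => ?_
  rw [Finset.HasAntidiagonal.mem_antidiagonal] at hx
  rw [← hx, smul_mul_assoc, mul_smul_comm, ← add_smul, Nat.cast_add]

theorem euler_formalExp {f : PowerSeries A} (hf : PowerSeries.coeff 0 f = 0)
    (comm : Commute f (euler f)) : euler (formalExp f) = formalExp f * euler f := by
  ext m
  rw [coeff_euler]
  refine leibniz_formalExp (d := fun m => (m : ℂ) • LinearMap.id) (fun i j a b => ?_) hf
    (fun m => coeff_euler f m) comm m
  simp only [LinearMap.smul_apply, LinearMap.id_apply, Nat.cast_add, smul_mul_assoc,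
    mul_smul_comm]
  exact add_smul _ _ _

end FormalExp

/-! ### Exponentials of `η(t, z)` and of `η(∂̃_t, w)`. -/

theorem coeff_eta_zero (c : ℂ) : PowerSeries.coeff 0 (c • eta) = 0 := by
  simp [eta]

theorem coeff_etaDer_zero (c : ℂ) : PowerSeries.coeff 0 (c • etaDer) = 0 := by
  simp [etaDer]

/-- The Euler derivative of the product vanishes, so in characteristic zero only the constant term
survives. -/
theorem formalExp_neg_mul_formalExp (c : ℂ) :
    formalExp (c • eta) * formalExp ((-c) • eta) = 1 := by
  have h : euler (formalExp (c • eta) * formalExp ((-c) • eta)) = 0 := by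
    rw [euler_mul, euler_formalExp (coeff_eta_zero _) (Commute.all _ _),
      euler_formalExp (coeff_eta_zero _) (Commute.all _ _)]
    have : euler ((-c) • eta) = - euler (c • eta) := by
      ext1 m
      simp [coeff_euler]
    rw [this]
    ring
  ext1 m
  rcases Nat.eq_zero_or_pos m with rfl | hm
  · simp [PowerSeries.coeff_mul]
  · have h1 := congrArg (PowerSeries.coeff m) h
    rw [coeff_euler, map_zero, smul_eq_zero] at h1
    rw [h1.resolve_left (Nat.cast_ne_zero.mpr hm.ne'), PowerSeries.coeff_one, if_neg hm.ne']

/-- The coefficient of `w^j` in `w d/dw η(∂̃_t, w)`. -/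
def derMode (j : ℕ) : Derivation ℂ Poly Poly :=
  if h : 0 < j then MvPolynomial.pderiv (j.toPNat h) else 0

theorem derMode_zero : derMode 0 = 0 := by simp [derMode]

theorem derMode_comm (i j : ℕ) (P : Poly) :
    derMode i (derMode j P) = derMode j (derMode i P) := by
  have h : ⁅derMode i, derMode j⁆ = 0 := by
    refine MvPolynomial.derivation_ext fun l => ?_
    rw [Derivation.commutator_apply]
    unfold derMode
    split_ifs <;> simp [MvPolynomial.pderiv_X, Pi.single_apply, apply_ite]
  have h1 := congrArg (fun D : Derivation ℂ Poly Poly => D P) h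
  rw [Derivation.commutator_apply] at h1
  exact sub_eq_zero.mp h1

theorem coeff_euler_etaDer (c : ℂ) (j : ℕ) :
    PowerSeries.coeff j (euler (c • etaDer)) = c • (derMode j).toLinearMap := by
  rw [coeff_euler, PowerSeries.coeff_smul, etaDer, PowerSeries.coeff_mk, derMode]
  split_ifs with h
  · rw [smul_smul, smul_smul]
    have : (j : ℂ) ≠ 0 := Nat.cast_ne_zero.mpr h.ne'
    congr 1
    field_simp
  · simp

theorem coeff_etaDer (c : ℂ) (j : ℕ) :
    PowerSeries.coeff j (c • etaDer) = (c * (j : ℂ)⁻¹) • (derMode j).toLinearMap := by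
  rw [PowerSeries.coeff_smul, etaDer, PowerSeries.coeff_mk, derMode]
  split_ifs with h
  · rw [smul_smul]; rfl
  · simp

theorem commute_etaDer_euler (c : ℂ) : Commute (c • etaDer) (euler (c • etaDer)) := by
  ext1 m
  rw [PowerSeries.coeff_mul, PowerSeries.coeff_mul, ← Finset.Nat.sum_antidiagonal_swap]
  refine Finset.sum_congr rfl fun x _ => ?_
  simp only [Prod.fst_swap, Prod.snd_swap, coeff_etaDer, coeff_euler_etaDer]
  refine LinearMap.ext fun P => ?_
  simp [derMode_comm x.1 x.2, smul_smul, mul_comm]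

/-- The coefficient of `w^m` in `exp (c η(∂̃_t, w))`. -/
def shiftMode (c : ℂ) (m : ℕ) : Module.End ℂ Poly :=
  PowerSeries.coeff m (formalExp (c • etaDer))

theorem shiftMode_zero (c : ℂ) (P : Poly) : shiftMode c 0 P = P := by
  simp [shiftMode]

/-- The equation `w d/dw exp f = exp f · w d/dw f`, read off coefficientwise. For `m > 0` it
determines the mode `m` from lower ones, because `derMode 0 = 0`; the later inductions all rest on
this. -/
theorem shiftMode_rec (c : ℂ) (m : ℕ) (P : Poly) :
    (m : ℂ) • shiftMode c m P =
      ∑ x ∈ Finset.HasAntidiagonal.antidiagonal m, c • shiftMode c x.1 (derMode x.2 P) := by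
  have h := congrArg (PowerSeries.coeff m)
    (euler_formalExp (coeff_etaDer_zero c) (commute_etaDer_euler c))
  rw [coeff_euler, PowerSeries.coeff_mul] at h
  have h1 := congrArg (fun T : Module.End ℂ Poly => T P) h
  simp only [LinearMap.smul_apply, LinearMap.sum_apply, coeff_euler_etaDer] at h1
  rw [shiftMode, h1]
  refine Finset.sum_congr rfl fun x _ => ?_
  simp [shiftMode]

/-! ### The shift operator is multiplicative -/

theorem sum_antidiagonal_assoc {M : Type} [AddCommMonoid M] (m : ℕ) (f : ℕ → ℕ → ℕ → M) :
    ∑ x ∈ Finset.HasAntidiagonal.antidiagonal m,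
        ∑ y ∈ Finset.HasAntidiagonal.antidiagonal x.1, f y.1 y.2 x.2 =
      ∑ x ∈ Finset.HasAntidiagonal.antidiagonal m,
        ∑ y ∈ Finset.HasAntidiagonal.antidiagonal x.2, f x.1 y.1 y.2 := by
  rw [Finset.sum_sigma', Finset.sum_sigma']
  refine Finset.sum_bij' (fun x _ => ⟨(x.2.1, x.2.2 + x.1.2), (x.2.2, x.1.2)⟩)
    (fun x _ => ⟨(x.1.1 + x.2.1, x.2.2), (x.1.1, x.2.1)⟩) ?_ ?_ ?_ ?_ ?_
  all_goals
    rintro ⟨⟨a, b⟩, c, d⟩ h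
    simp only [Finset.mem_sigma, Finset.HasAntidiagonal.mem_antidiagonal] at h ⊢
    try obtain ⟨h1, h2⟩ := h
    try subst h2
    try subst h1
    try simp [add_assoc]

theorem sum_antidiagonal_right_comm {M : Type} [AddCommMonoid M] (m : ℕ) (f : ℕ → ℕ → ℕ → M) :
    ∑ x ∈ Finset.HasAntidiagonal.antidiagonal m,
        ∑ y ∈ Finset.HasAntidiagonal.antidiagonal x.1, f y.1 y.2 x.2 =
      ∑ x ∈ Finset.HasAntidiagonal.antidiagonal m,
        ∑ y ∈ Finset.HasAntidiagonal.antidiagonal x.1, f y.1 x.2 y.2 := by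
  rw [sum_antidiagonal_assoc m f, sum_antidiagonal_assoc m fun a b c => f a c b]
  exact Finset.sum_congr rfl fun x _ =>
    (Finset.Nat.sum_antidiagonal_swap (n := x.2) (f := fun y => f x.1 y.1 y.2)).symm

/-- The exponential of a derivation is an algebra homomorphism. By the Leibniz rule both sides
satisfy the recursion `shiftMode_rec`, which has a unique solution after division by `m`. -/
theorem shiftMode_mul (c : ℂ) (m : ℕ) (P Q : Poly) :
    shiftMode c m (P * Q) = ∑ x ∈ Finset.HasAntidiagonal.antidiagonal m,
      shiftMode c x.1 P * shiftMode c x.2 Q := by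
  induction m using Nat.strong_induction_on generalizing P Q with
  | _ m ih =>
  rcases Nat.eq_zero_or_pos m with rfl | hm
  · simp [shiftMode_zero]
  have key : (m : ℂ) • shiftMode c m (P * Q) =
      (m : ℂ) • ∑ x ∈ Finset.HasAntidiagonal.antidiagonal m,
        shiftMode c x.1 P * shiftMode c x.2 Q := by
    have h1 : ∀ x ∈ Finset.HasAntidiagonal.antidiagonal m,
        c • shiftMode c x.1 (derMode x.2 (P * Q)) =
        (∑ y ∈ Finset.HasAntidiagonal.antidiagonal x.1,
          (c • shiftMode c y.1 (derMode x.2 P)) * shiftMode c y.2 Q) +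
        ∑ y ∈ Finset.HasAntidiagonal.antidiagonal x.1,
          shiftMode c y.1 P * (c • shiftMode c y.2 (derMode x.2 Q)) := fun x hx => by
      rw [Finset.HasAntidiagonal.mem_antidiagonal] at hx
      -- The term with `x.2 = 0` has `x.1 = m`, out of reach of the induction hypothesis, but
      -- `derMode 0` kills it.
      rcases Nat.eq_zero_or_pos x.2 with h0 | h0
      · simp [h0, derMode_zero]
      · rw [Derivation.leibniz, map_add, smul_eq_mul, smul_eq_mul, ih _ (by omega),
          mul_comm Q, ih _ (by omega), smul_add, Finset.smul_sum, Finset.smul_sum, add_comm]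
        simp only [smul_mul_assoc, mul_smul_comm]
    rw [shiftMode_rec, Finset.sum_congr rfl h1, Finset.sum_add_distrib,
      sum_antidiagonal_right_comm m fun b l j =>
        (c • shiftMode c b (derMode j P)) * shiftMode c l Q,
      sum_antidiagonal_assoc m fun b l j =>
        shiftMode c b P * (c • shiftMode c l (derMode j Q)),
      ← Finset.sum_add_distrib, Finset.smul_sum]
    refine Finset.sum_congr rfl fun x hx => ?_
    rw [Finset.HasAntidiagonal.mem_antidiagonal] at hx
    rw [← Finset.sum_mul, ← Finset.mul_sum, ← shiftMode_rec, ← shiftMode_rec, ← hx, Nat.cast_add,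
      add_smul, smul_mul_assoc, mul_smul_comm]
  exact smul_right_injective _ (Nat.cast_ne_zero.mpr hm.ne' : (m : ℂ) ≠ 0) key

theorem shiftMode_one (c : ℂ) {m : ℕ} (hm : m ≠ 0) : shiftMode c m 1 = 0 := by
  have h := shiftMode_rec c m 1
  simp only [Derivation.map_one_eq_zero, map_zero, smul_zero, Finset.sum_const_zero,
    smul_eq_zero] at h
  exact h.resolve_left (Nat.cast_ne_zero.mpr hm)

/-- The shift `P ↦ exp (c η(∂̃_t, w)) P` as a multiplicative map. -/
def shift (c : ℂ) : Poly →* PowerSeries Poly where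
  toFun P := PowerSeries.mk fun m => shiftMode c m P
  map_one' := by
    ext1 m
    rw [PowerSeries.coeff_mk, PowerSeries.coeff_one]
    split_ifs with h
    · rw [h, shiftMode_zero]
    · exact shiftMode_one c h
  map_mul' P Q := by
    ext1 m
    rw [PowerSeries.coeff_mk, shiftMode_mul, PowerSeries.coeff_mul]
    simp only [PowerSeries.coeff_mk]

theorem coeff_shift (c : ℂ) (P : Poly) (m : ℕ) :
    PowerSeries.coeff m (shift c P) = shiftMode c m P :=
  PowerSeries.coeff_mk m fun m => shiftMode c m P

/-! ### The polynomials `p_r(-t)` -/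

/-- The polynomials `p_r(-t)`. -/
def pNeg (r : ℤ) : Poly := intCoeff (formalExp (((-1 : ℤ) : ℂ) • eta)) r

theorem pNeg_natCast (r : ℕ) :
    pNeg r = PowerSeries.coeff r (formalExp (((-1 : ℤ) : ℂ) • eta)) := by
  simp [pNeg, intCoeff]

theorem pNeg_of_neg {r : ℤ} (hr : r < 0) : pNeg r = 0 := by
  simp [pNeg, intCoeff, not_le.mpr hr]

theorem pderiv_pNeg (j : ℕ+) (r : ℤ) : MvPolynomial.pderiv j (pNeg r) = -pNeg (r - (j : ℕ)) := by
  rcases lt_or_ge r 0 with hr | hr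
  · rw [pNeg_of_neg hr, pNeg_of_neg (by omega), map_zero, neg_zero]
  lift r to ℕ using hr
  -- Here `∂/∂t_j` sends `-η(t, z)` to `-z^j`, which shifts the index by `j`.
  have h := leibniz_formalExp (d := fun _ => (MvPolynomial.pderiv j).toLinearMap)
    (f := ((-1 : ℤ) : ℂ) • eta) (g := -PowerSeries.X ^ (j : ℕ)) (fun _ _ a b => by
      simp [Derivation.leibniz]; ring) (coeff_eta_zero _) (fun m => by
      rw [PowerSeries.coeff_smul, eta, PowerSeries.coeff_mk, map_neg, PowerSeries.coeff_X_pow]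
      split_ifs with h1 h2 h2
      · have : m.toPNat h2 = j := PNat.eq h1
        simp [this]
      · exact absurd (h1 ▸ j.pos) h2
      · have : m.toPNat h2 ≠ j := fun h3 => h1 (by rw [← h3]; rfl)
        simp [MvPolynomial.pderiv_X_of_ne this]
      · simp) (Commute.all _ _) r
  rw [← pNeg_natCast, mul_neg, map_neg, PowerSeries.coeff_mul_X_pow'] at h
  refine Eq.trans h ?_
  split_ifs with h1
  · rw [← pNeg_natCast, Nat.cast_sub h1]
  · rw [pNeg_of_neg (by omega)]

theorem derMode_pNeg {j : ℕ} (hj : 0 < j) (r : ℤ) : derMode j (pNeg r) = -pNeg (r - j) := by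
  rw [derMode, dif_pos hj, pderiv_pNeg]
  rfl

/-- The coefficients of `(1 - x)²`. -/
def sqCoeff : ℕ → ℂ
  | 0 => 1
  | 1 => -2
  | 2 => 1
  | _ + 3 => 0

/-- Coefficientwise form of `-2(1 - x)² / (1 - x) = d/dx (1 - x)²`. -/
theorem sum_range_sqCoeff (m : ℕ) :
    ∑ a ∈ Finset.range (m + 1), -2 * sqCoeff a = ((m + 1 : ℕ) : ℂ) * sqCoeff (m + 1) := by
  match m with
  | 0 => simp [sqCoeff]
  | 1 => simp [sqCoeff, Finset.sum_range_succ]; norm_num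
  | k + 2 =>
    rw [Finset.sum_range_succ', Finset.sum_range_succ', Finset.sum_range_succ']
    simp [sqCoeff]
    norm_num

/-- Shifting `t_j` by `2w^j/j` multiplies `e^{-η(t,z)}` by `exp(2 log(1 - wz)) = (1 - wz)²`. -/
theorem shiftMode_pNeg (m : ℕ) (r : ℤ) :
    shiftMode 2 m (pNeg r) = sqCoeff m • pNeg (r - m) := by
  induction m using Nat.strong_induction_on generalizing r with
  | _ m ih =>
  rcases m with _ | m
  · simp [shiftMode_zero, sqCoeff]
  have h := shiftMode_rec 2 (m + 1) (pNeg r)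
  rw [Finset.Nat.sum_antidiagonal_eq_sum_range_succ_mk, Finset.sum_range_succ, Nat.sub_self,
    derMode_zero, Derivation.zero_apply, map_zero, smul_zero, add_zero] at h
  have h1 : ∀ a ∈ Finset.range (m + 1),
      (2 : ℂ) • shiftMode 2 a (derMode (m + 1 - a) (pNeg r)) =
        (-2 * sqCoeff a) • pNeg (r - (m + 1 : ℕ)) := fun a ha => by
    rw [Finset.mem_range] at ha
    rw [derMode_pNeg (by omega), map_neg, ih a ha, smul_neg, smul_smul, neg_mul, neg_smul,
      Nat.cast_sub ha.le]
    congr 3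
    ring
  rw [Finset.sum_congr rfl h1, ← Finset.sum_smul, sum_range_sqCoeff, mul_smul] at h
  exact smul_right_injective _ (Nat.cast_ne_zero.mpr m.succ_ne_zero : ((m + 1 : ℕ) : ℂ) ≠ 0) h

theorem shift_pNeg (r : ℤ) : shift 2 (pNeg r) =
    ∑ e : Fin 3, PowerSeries.monomial e.val (sqCoeff e • pNeg (r - (e.val : ℤ))) := by
  ext1 m
  rw [coeff_shift, shiftMode_pNeg, map_sum]
  simp only [PowerSeries.coeff_monomial]
  match m with
  | 0 | 1 | 2 => simp [Fin.sum_univ_three]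
  | m + 3 => simp [Fin.sum_univ_three, sqCoeff]

theorem monomial_prod {n : ℕ} (d : Fin n → ℕ) (R : Fin n → Poly) :
    ∏ i, PowerSeries.monomial (d i) (R i) = PowerSeries.monomial (∑ i, d i) (∏ i, R i) := by
  induction n with
  | zero => simp
  | succ n ih =>
    rw [Fin.prod_univ_succ, ih, PowerSeries.monomial_mul_monomial, Fin.prod_univ_succ,
      Fin.sum_univ_succ]

theorem shift_prod_pNeg {n : ℕ} (r : Fin n → ℤ) : shift 2 (∏ i, pNeg (r i)) =
    ∑ e : Fin n → Fin 3, PowerSeries.monomial (∑ i, (e i).val)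
      ((∏ i, sqCoeff (e i)) • ∏ i, pNeg (r i - ((e i).val : ℤ))) := by
  rw [map_prod]
  simp only [shift_pNeg]
  rw [Finset.prod_univ_sum, Fintype.piFinset_univ]
  refine Finset.sum_congr rfl fun e _ => ?_
  rw [monomial_prod, Finset.prod_smul]

/-! ### Modes of `F(z)` on products of the `p_r(-t)`. -/

theorem polyMode_eq_sum {ι : Type} (S : Finset ι) (d : ι → ℕ) (R : ι → Poly) {P : Poly}
    (h : shift 2 P = ∑ a ∈ S, PowerSeries.monomial (d a) (R a)) (s : ℤ) :
    polyMode (-1) s P = ∑ a ∈ S, pNeg (s + d a) * R a := by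
  have hi : ∀ i : ℕ, (LinearMap.mulLeft ℂ (intCoeff (formalExp (((-1 : ℤ) : ℂ) • eta)) (s + i)) ∘ₗ
        PowerSeries.coeff i (formalExp ((-2 * ((-1 : ℤ) : ℂ)) • etaDer))) P =
      ∑ a ∈ S, if i = d a then pNeg (s + i) * R a else 0 := fun i => by
    have h2 : (-2 * ((-1 : ℤ) : ℂ)) = 2 := by norm_num
    have h1 : PowerSeries.coeff i (formalExp ((2 : ℂ) • etaDer)) P =
        ∑ a ∈ S, if i = d a then R a else 0 := by
      have := congrArg (PowerSeries.coeff i) h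
      rw [coeff_shift, map_sum] at this
      simp only [PowerSeries.coeff_monomial] at this
      exact this
    rw [LinearMap.comp_apply, h2, h1, LinearMap.mulLeft_apply, Finset.mul_sum]
    simp only [mul_ite, mul_zero]
    rfl
  change (∑ᶠ i : ℕ, _) = _
  rw [finsum_congr hi, finsum_eq_sum_of_support_subset (s := S.image d), Finset.sum_comm]
  · refine Finset.sum_congr rfl fun a ha => ?_
    rw [Finset.sum_ite_eq' (S.image d) (d a) fun i => pNeg (s + i) * R a,
      if_pos (Finset.mem_image_of_mem d ha)]
  · intro i hi
    obtain ⟨a, ha, hne⟩ := Finset.exists_ne_zero_of_sum_ne_zero hi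
    have : i = d a := by
      by_contra h0
      exact hne (if_neg h0)
    exact this ▸ Finset.mem_coe.mpr (Finset.mem_image_of_mem d ha)

theorem polyMode_prod_pNeg {n : ℕ} (s : ℤ) (r : Fin n → ℤ) :
    polyMode (-1) s (∏ i, pNeg (r i)) = ∑ e : Fin n → Fin 3, (∏ i, sqCoeff (e i)) •
      (pNeg (s + (∑ i, (e i).val : ℕ)) * ∏ i, pNeg (r i - ((e i).val : ℤ))) := by
  rw [polyMode_eq_sum _ _ _ (shift_prod_pNeg r)]
  simp only [mul_smul_comm]

/-! ### Powers of `F` as determinants -/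

/-- The linear map sending a monomial `∏ xᵢ ^ μᵢ` to `∏ p_{N - 1 - μᵢ}(-t)`. -/
def umbral (N n : ℕ) : MvPolynomial (Fin n) ℂ →ₗ[ℂ] Poly :=
  (MvPolynomial.basisMonomials (Fin n) ℂ).constr ℂ fun μ => ∏ i, pNeg ((N : ℤ) - 1 - μ i)

theorem umbral_prod_X (N n : ℕ) (f : Fin n → ℕ) :
    umbral N n (∏ i, MvPolynomial.X i ^ f i) = ∏ i, pNeg ((N : ℤ) - 1 - f i) := by
  have h : (∏ i, MvPolynomial.X i ^ f i : MvPolynomial (Fin n) ℂ) =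
      MvPolynomial.basisMonomials (Fin n) ℂ (Finsupp.equivFunOnFinite.symm f) := by
    change _ = MvPolynomial.monomial _ 1
    rw [MvPolynomial.monomial_eq, Finsupp.prod_fintype]
    · simp
    · simp
  rw [h, umbral, Module.Basis.constr_basis]
  rfl

theorem sq_sub_eq_sum {R : Type} [CommRing R] [Algebra ℂ R] (x y : R) :
    (x - y) ^ 2 = ∑ e : Fin 3, sqCoeff e • (x ^ (2 - e.val) * y ^ e.val) := by
  simp only [Fin.sum_univ_three]
  simp [sqCoeff, Algebra.smul_def, map_ofNat]
  ring

theorem prod_pow_mul_prod {R : Type} [CommRing R] {n : ℕ} (x : R) (y : Fin n → R)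
    (a b c : Fin n → ℕ) : (∏ i, y i ^ a i) * ∏ i, (x ^ b i * y i ^ c i) =
      x ^ (∑ i, b i) * ∏ i, y i ^ (a i + c i) := by
  simp only [pow_add]
  rw [Finset.prod_mul_distrib, Finset.prod_mul_distrib, Finset.prod_pow_eq_pow_sum, mul_left_comm]

/-- `umbral N n f` is the coefficient of `∏ x_i^{N-1}` in `f(x) ∏ e^{-η(t,x_i)}`. A further vertex
operator brings a new variable `x_0`, and moving it past each old factor costs `(x_0 - x_i)²`. -/
theorem polyMode_umbral (N n : ℕ) (f : MvPolynomial (Fin n) ℂ) :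
    polyMode (-1) ((N : ℤ) - 1 - 2 * n) (umbral N n f) =
      umbral N (n + 1) (MvPolynomial.rename Fin.succ f *
        ∏ i : Fin n, (MvPolynomial.X 0 - MvPolynomial.X i.succ) ^ 2) := by
  induction f using MvPolynomial.induction_on' with
  | add f g hf hg => rw [map_add, map_add, hf, hg, map_add, add_mul, map_add]
  | monomial μ a =>
    have hμ : (MvPolynomial.monomial μ a : MvPolynomial (Fin n) ℂ) =
        a • ∏ i, MvPolynomial.X i ^ μ i := by
      rw [MvPolynomial.monomial_eq, Finsupp.prod_fintype _ _ (by simp), MvPolynomial.C_mul']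
    have hprod : MvPolynomial.rename Fin.succ (∏ i, MvPolynomial.X i ^ μ i) *
          ∏ i : Fin n, (MvPolynomial.X 0 - MvPolynomial.X i.succ) ^ 2 =
        ∑ e : Fin n → Fin 3, (∏ i, sqCoeff (e i)) •
          ∏ j : Fin (n + 1), (MvPolynomial.X j : MvPolynomial (Fin (n + 1)) ℂ) ^
            (Fin.cons (∑ i, (2 - (e i).val)) (fun i => μ i + (e i).val) : Fin (n + 1) → ℕ) j := by
      simp only [sq_sub_eq_sum]
      rw [Finset.prod_univ_sum, Fintype.piFinset_univ, Finset.mul_sum]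
      refine Finset.sum_congr rfl fun e _ => ?_
      rw [Finset.prod_smul, mul_smul_comm, Fin.prod_univ_succ, map_prod]
      simp only [map_pow, MvPolynomial.rename_X, Fin.cons_zero, Fin.cons_succ]
      rw [prod_pow_mul_prod]
    rw [hμ, map_smul, map_smul, map_smul, smul_mul_assoc, map_smul, hprod, map_sum,
      umbral_prod_X, polyMode_prod_pNeg]
    congr 1
    refine Finset.sum_congr rfl fun e _ => ?_
    rw [map_smul, umbral_prod_X, Fin.prod_univ_succ]
    simp only [Fin.cons_zero, Fin.cons_succ]
    congr 2
    · congr 1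
      -- Each factor `(x_0 - x_i)²` is homogeneous of degree 2, so the exponent of `x_0` is `2n - ∑
      -- e_i`; this absorbs the `-2n` in the index of the mode.
      have h1 : ∑ i, (2 - (e i).val) + ∑ i, (e i).val = 2 * n := by
        rw [← Finset.sum_add_distrib, Finset.sum_congr rfl (g := fun _ => 2)
          fun i _ => by have := (e i).isLt; omega]
        simp [mul_comm]
      omega
    · refine Finset.prod_congr rfl fun i _ => ?_
      congr 1
      push_cast
      ring

/-- The Vandermonde determinant in the variables `x₁, …, xₙ`. -/
def vanDet (n : ℕ) : MvPolynomial (Fin n) ℂ :=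
  (Matrix.vandermonde (MvPolynomial.X : Fin n → MvPolynomial (Fin n) ℂ)).det

theorem vanDet_succ_sq (n : ℕ) : vanDet (n + 1) ^ 2 =
    MvPolynomial.rename Fin.succ (vanDet n ^ 2) *
      ∏ i : Fin n, (MvPolynomial.X 0 - MvPolynomial.X i.succ) ^ 2 := by
  have h : vanDet (n + 1) = (∏ i : Fin n, (MvPolynomial.X i.succ - MvPolynomial.X 0)) *
      MvPolynomial.rename Fin.succ (vanDet n) := by
    rw [vanDet, Matrix.det_vandermonde, Fin.prod_univ_succ, Fin.prod_Ioi_zero, vanDet,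
      Matrix.det_vandermonde]
    simp only [Fin.prod_Ioi_succ, map_prod, map_sub, MvPolynomial.rename_X]
  rw [h, mul_pow, map_pow, ← Finset.prod_pow,
    Finset.prod_congr rfl fun (i : Fin n) _ =>
      sub_sq_comm (MvPolynomial.X i.succ : MvPolynomial (Fin (n + 1)) ℂ) (MvPolynomial.X 0)]
  exact mul_comm _ _

theorem F_pow_vec (k n : ℕ) : (F 0 ^ n) (vec 1 k) =
    vec (umbral (2 * k) n (vanDet n ^ 2)) ((k : ℤ) - n) := by
  induction n with
  | zero =>
    have := umbral_prod_X (2 * k) 0 Fin.elim0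
    simp only [Finset.univ_eq_empty, Finset.prod_empty] at this
    simp [vanDet, Matrix.det_fin_zero, this]
  | succ n ih =>
    rw [pow_succ', Module.End.mul_apply, ih, F, vertexMode_vec, vanDet_succ_sq, ← polyMode_umbral]
    congr 1
    · congr 2
      push_cast
      ring
    · push_cast
      ring

/-- Expand both Vandermonde factors over permutations `σ` and `τ`. For fixed `σ`, the sum over `τ`
is the Hankel determinant with permuted rows; its sign cancels that of `σ`, so each of the `n!`
permutations contributes the same determinant. -/
theorem umbral_vanDet_sq (N n : ℕ) : umbral N n (vanDet n ^ 2) =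
    (n ! : ℂ) • (Matrix.of fun i j : Fin n => pNeg ((N : ℤ) - 1 - i - j)).det := by
  set A : Matrix (Fin n) (Fin n) Poly := Matrix.of fun i j => pNeg ((N : ℤ) - 1 - i - j) with hA
  have hdet : vanDet n = ∑ σ : Equiv.Perm (Fin n),
      ((Equiv.Perm.sign σ : ℤ) : ℂ) • ∏ i, MvPolynomial.X i ^ (σ i : ℕ) := by
    rw [vanDet, ← Matrix.det_transpose, Matrix.det_apply']
    refine Finset.sum_congr rfl fun σ _ => ?_
    rw [Algebra.smul_def, map_intCast]
    rfl
  have hinner : ∀ σ : Equiv.Perm (Fin n), ∑ τ : Equiv.Perm (Fin n),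
      ((Equiv.Perm.sign τ : ℤ) : ℂ) • ∏ i, pNeg ((N : ℤ) - 1 - ((σ i : ℕ) + (τ i : ℕ) : ℕ)) =
      ((Equiv.Perm.sign σ : ℤ) : ℂ) • A.det := fun σ => by
    have h := Matrix.det_permute σ A
    rw [← Matrix.det_transpose, Matrix.det_apply'] at h
    rw [Algebra.smul_def, map_intCast, ← h]
    refine Finset.sum_congr rfl fun τ _ => ?_
    rw [Algebra.smul_def, map_intCast]
    congr 1
    refine Finset.prod_congr rfl fun i _ => ?_
    simp only [hA, Matrix.transpose_apply, Matrix.submatrix_apply, Matrix.of_apply, id]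
    congr 1
    push_cast
    ring
  rw [pow_two]
  conv_lhs => rw [hdet]
  rw [Finset.sum_mul_sum, map_sum]
  have : ∀ σ ∈ (Finset.univ : Finset (Equiv.Perm (Fin n))), umbral N n
      (∑ τ : Equiv.Perm (Fin n),
        (((Equiv.Perm.sign σ : ℤ) : ℂ) • ∏ i, (MvPolynomial.X i ^ (σ i : ℕ))) *
        (((Equiv.Perm.sign τ : ℤ) : ℂ) • ∏ i, (MvPolynomial.X i ^ (τ i : ℕ)))) = A.det :=
    fun σ _ => by
    simp only [smul_mul_smul_comm, ← Finset.prod_mul_distrib, ← pow_add, map_sum, map_smul,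
      umbral_prod_X, mul_smul]
    rw [← Finset.smul_sum, hinner, smul_smul, ← Int.cast_mul, ← Units.val_mul,
      Int.units_mul_self, Units.val_one, Int.cast_one, one_smul]
  rw [Finset.sum_congr rfl this, Finset.sum_const, Finset.card_univ, Fintype.card_perm,
    Fintype.card_fin, Nat.cast_smul_eq_nsmul]

/-! ### The dual Jacobi–Trudi identity for rectangles -/

/-- Every pair is an inversion, and there are `n(n-1)/2` pairs. -/
theorem sign_revPerm (n : ℕ) :
    ((Equiv.Perm.sign (Fin.revPerm : Equiv.Perm (Fin n)) : ℤ)) = (-1) ^ (n * (n - 1) / 2) := by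
  have h : ∀ j ∈ (Finset.univ : Finset (Fin n)), (∏ i ∈ Finset.Iio j,
      if Fin.revPerm i < Fin.revPerm j then (1 : ℤˣ) else -1) = (-1) ^ (j : ℕ) := fun j _ => by
    rw [Finset.prod_congr rfl (g := fun _ => -1) fun i hi => if_neg ?_, Finset.prod_const,
      Fin.card_Iio]
    rw [Finset.mem_Iio] at hi
    simpa using hi.le
  rw [Equiv.Perm.sign_eq_prod_prod_Iio, Finset.prod_congr rfl h, Finset.prod_pow_eq_pow_sum,
    Fin.sum_univ_eq_sum_range (fun i => i), Finset.sum_range_id]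
  simp

theorem p_of_neg {r : ℤ} (hr : r < 0) : p r = 0 := by
  simp [p, intCoeff, not_le.mpr hr]

theorem p_zero : p 0 = 1 := by
  simp [p, intCoeff]

theorem sum_p_mul_pNeg (m : ℕ) :
    ∑ x ∈ Finset.HasAntidiagonal.antidiagonal m, p x.1 * pNeg x.2 = if m = 0 then 1 else 0 := by
  have h := congrArg (PowerSeries.coeff m) (formalExp_neg_mul_formalExp 1)
  rw [one_smul, PowerSeries.coeff_mul, PowerSeries.coeff_one] at h
  rw [← h]
  refine Finset.sum_congr rfl fun x _ => ?_
  rw [pNeg_natCast]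
  simp [p, intCoeff]

/-- Only `i ≤ l ≤ c` contributes, so with `c < N` truncating to `N` indices loses nothing: the
finite Toeplitz matrices are still mutually inverse. -/
theorem sum_range_p_mul_pNeg {N i c : ℕ} (hc : c < N) :
    ∑ l ∈ Finset.range N, p ((l : ℤ) - i) * pNeg ((c : ℤ) - l) = if i = c then 1 else 0 := by
  have h1 : ∑ l ∈ Finset.range N, p ((l : ℤ) - i) * pNeg ((c : ℤ) - l) =
      ∑ l ∈ Finset.Ico i (c + 1), p ((l : ℤ) - i) * pNeg ((c : ℤ) - l) := by
    symm
    refine Finset.sum_subset (fun l hl => ?_) fun l _ hl => ?_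
    · rw [Finset.mem_Ico] at hl
      rw [Finset.mem_range]
      omega
    · rw [Finset.mem_Ico] at hl
      rcases lt_or_ge l i with h | h
      · rw [p_of_neg (by omega), zero_mul]
      · rw [pNeg_of_neg (by omega), mul_zero]
  rw [h1]
  rcases lt_or_ge c i with h | h
  · rw [Finset.Ico_eq_empty (by omega), Finset.sum_empty, if_neg (by omega)]
  · obtain ⟨m, rfl⟩ := Nat.exists_eq_add_of_le h
    have h2 := sum_p_mul_pNeg m
    rw [Finset.Nat.sum_antidiagonal_eq_sum_range_succ_mk] at h2
    rw [Finset.sum_Ico_eq_sum_range, show i + m + 1 - i = m + 1 by omega]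
    refine Eq.trans ?_ (h2.trans ?_)
    · refine Finset.sum_congr rfl fun l hl => ?_
      rw [Finset.mem_range] at hl
      simp only [Nat.cast_sub (show l ≤ m by omega)]
      congr 2 <;> omega
    · congr 1
      simp

/-- Jacobi's complementary minor argument. The unitriangular matrix `T` turns the first `n` columns
of `R` into unit vectors and the others into columns of `T`. Hence `R` and `T * R` have the same
determinant, which is the Hankel determinant on one side and the Schur determinant up to sign on the
other. -/
theorem det_pNeg_eq (n a : ℕ) :
    (Matrix.of fun i j : Fin n => pNeg (((a + n : ℕ) : ℤ) - 1 - i - j)).det =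
      ((-1) ^ ((a + n) * (a + n - 1) / 2) * (-1) ^ (a * (a - 1) / 2)) * schurRect a n := by
  set N := a + n with hN
  let e : Fin a ⊕ Fin n ≃ Fin N := finSumFinEquiv
  have he1 : ∀ i, (e (Sum.inl i) : ℕ) = i := fun _ => rfl
  have he2 : ∀ j, (e (Sum.inr j) : ℕ) = a + j := fun _ => rfl
  let e' : Fin n ⊕ Fin a ≃ Fin N := finSumFinEquiv.trans (finCongr (by omega))
  let T : Matrix (Fin N) (Fin N) Poly := Matrix.of fun i j => p ((j : ℤ) - i)
  let R : Matrix (Fin N) (Fin N) Poly := Matrix.of fun i j =>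
    if (j : ℕ) < n then pNeg ((N : ℤ) - 1 - j - i) else if i = j then 1 else 0
  have hT : T.det = 1 := by
    rw [Matrix.det_of_isUpperTriangular]
    · simp [T, p_zero]
    · intro i j hij
      exact p_of_neg (by simpa using hij)
  have hR : R.det = (Matrix.of fun i j : Fin n => pNeg ((N : ℤ) - 1 - i - j)).det := by
    rw [← Matrix.det_submatrix_equiv_self e' R, ← Matrix.fromBlocks_toBlocks (R.submatrix e' e')]
    have h12 : (R.submatrix e' e').toBlocks₁₂ = 0 := by
      ext1 i j
      simp [R, e', Matrix.toBlocks₁₂, Fin.ext_iff]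
      omega
    have h22 : (R.submatrix e' e').toBlocks₂₂ = 1 := by
      ext1 i j
      simp [R, e', Matrix.toBlocks₂₂, Matrix.one_apply, Fin.ext_iff]
    rw [h12, h22, Matrix.det_fromBlocks_zero₁₂, Matrix.det_one, mul_one]
    congr 1
    ext1 i j
    simp [R, e', Matrix.toBlocks₁₁, sub_right_comm]
  have hTR : ∀ i j, (T * R) i j = if (j : ℕ) < n then (if (i : ℕ) + j + 1 = N then 1 else 0)
      else p ((j : ℤ) - i) := fun i j => by
    rw [Matrix.mul_apply]
    split_ifs with h h'
    · have h1 := sum_range_p_mul_pNeg (N := N) (i := i) (c := N - 1 - j) (by omega)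
      rw [if_pos (by omega), ← Fin.sum_univ_eq_sum_range
        (fun l => p ((l : ℤ) - i) * pNeg (((N - 1 - j : ℕ) : ℤ) - l))] at h1
      rw [← h1]
      refine Finset.sum_congr rfl fun l _ => ?_
      simp only [T, R, Matrix.of_apply, if_pos h]
      congr 2
      omega
    · have h1 := sum_range_p_mul_pNeg (N := N) (i := i) (c := N - 1 - j) (by omega)
      rw [if_neg (by omega), ← Fin.sum_univ_eq_sum_range
        (fun l => p ((l : ℤ) - i) * pNeg (((N - 1 - j : ℕ) : ℤ) - l))] at h1
      rw [← h1]
      refine Finset.sum_congr rfl fun l _ => ?_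
      simp only [T, R, Matrix.of_apply, if_pos h]
      congr 2
      omega
    · simp [T, R, h]
  -- Reversing all `N` columns makes `T * R` block lower triangular with an identity block. The
  -- remaining `a × a` block is the Jacobi–Trudi matrix with its columns reversed, hence the two
  -- signs.
  have hrev : ((T * R).submatrix id Fin.revPerm).det =
      ((Equiv.Perm.sign (Fin.revPerm : Equiv.Perm (Fin a)) : ℤ) : Poly) * schurRect a n := by
    rw [schurRect, schur, ← Matrix.det_permute', ← Matrix.det_submatrix_equiv_self e,
      ← Matrix.fromBlocks_toBlocks (((T * R).submatrix id Fin.revPerm).submatrix e e)]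
    have h12 : (((T * R).submatrix id Fin.revPerm).submatrix e e).toBlocks₁₂ = 0 := by
      ext1 i j
      simp [hTR, he1, he2, Matrix.toBlocks₁₂, Fin.val_rev]
      rw [if_pos (by omega), if_neg (by omega)]
    have h22 : (((T * R).submatrix id Fin.revPerm).submatrix e e).toBlocks₂₂ = 1 := by
      ext1 i j
      simp [hTR, he2, Matrix.toBlocks₂₂, Matrix.one_apply, Fin.ext_iff, Fin.val_rev]
      rw [if_pos (by omega)]
      congr 1
      rw [eq_iff_iff]
      omega
    rw [h12, h22, Matrix.det_fromBlocks_zero₁₂, Matrix.det_one, mul_one]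
    congr 1
    ext1 i j
    simp [hTR, he1, Matrix.toBlocks₁₁, Fin.val_rev]
    rw [if_neg (by omega)]
    congr 1
    omega
  rw [Matrix.det_permute', Matrix.det_mul, hT, one_mul, hR, sign_revPerm, sign_revPerm] at hrev
  have h : ∀ m : ℕ, ((-1 : Poly) ^ m) * (-1) ^ m = 1 := fun m => by
    rw [← mul_pow, neg_one_mul, neg_neg, one_pow]
  push_cast at hrev
  rw [mul_assoc, ← hrev, ← mul_assoc, h, one_mul]

/-- With `x`, `y`, `z` the three exponents, substituting `n = 2k - a` gives `x + y + z = 2(2k² - ka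
+ y)`, which is even. -/
theorem sign_rect {n a k : ℕ} (h : a + n = 2 * k) {R : Type} [CommRing R] :
    (-1 : R) ^ ((a + n) * (a + n - 1) / 2) * (-1) ^ (a * (a - 1) / 2) =
      (-1) ^ (n * (n + 1) / 2) := by
  obtain ⟨x, hx⟩ := Nat.even_mul_pred_self (a + n)
  obtain ⟨y, hy⟩ := Nat.even_mul_pred_self a
  obtain ⟨z, hz⟩ := Nat.even_mul_succ_self n
  rw [hx, hy, hz, ← two_mul, ← two_mul, ← two_mul, Nat.mul_div_cancel_left _ two_pos,
    Nat.mul_div_cancel_left _ two_pos, Nat.mul_div_cancel_left _ two_pos, ← pow_add]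
  have h1 : x = k * (2 * k - 1) := by
    have : 2 * x = 2 * (k * (2 * k - 1)) := by rw [two_mul, ← hx, h, mul_assoc]
    omega
  have he : Even (x + y + z) := by
    have hyz : (y : ℤ) + z + k = 2 * (k * k + k - k * a) + 2 * y - 0 := by
      have hy' : (a : ℤ) * (a - 1) = y + y := by
        rcases Nat.eq_zero_or_pos a with rfl | ha
        · have : y = 0 := by omega
          simp [this]
        · have := congrArg (Nat.cast : ℕ → ℤ) hy
          push_cast [Nat.cast_sub (show 1 ≤ a from ha)] at this
          exact this
      have hz' : (n : ℤ) * (n + 1) = z + z := by exact_mod_cast hz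
      have hn : (n : ℤ) = 2 * k - a := by omega
      rw [hn] at hz'
      linarith
    have hxk : (x : ℤ) = k * (2 * k - 1) := by
      rw [h1]
      rcases Nat.eq_zero_or_pos k with rfl | hk
      · simp
      · push_cast [Nat.cast_sub (show 1 ≤ 2 * k by omega)]
        ring
    have : ((x + y + z : ℕ) : ℤ) = 2 * (2 * k * k - k * a + y) := by
      push_cast
      linarith
    rw [← Int.even_coe_nat, this]
    exact even_two_mul _
  have h2 : (-1 : R) ^ (x + y) * (-1) ^ z = 1 := by rw [← pow_add, he.neg_one_pow]
  have h3 : (-1 : R) ^ z * (-1) ^ z = 1 := by rw [← mul_pow, neg_one_mul, neg_neg, one_pow]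
  calc (-1 : R) ^ (x + y) = (-1 : R) ^ (x + y) * ((-1) ^ z * (-1) ^ z) := by rw [h3, mul_one]
    _ = (-1) ^ z := by rw [← mul_assoc, h2, one_mul]

theorem vec_smul (c : ℂ) (P : Poly) (n : ℤ) : vec (c • P) n = c • vec P n := by
  rw [vec, vec, TensorProduct.smul_tmul']

theorem F_pow_vec_eq_schurRect (k n : ℕ) (h : n ≤ 2 * k) : (F 0 ^ n) (vec 1 k) =
    ((n ! : ℂ) * (-1 : ℂ) ^ (n * (n + 1) / 2)) •
      vec (schurRect (2 * k - n) n) ((k : ℤ) - (n : ℤ)) := by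
  have h1 := det_pNeg_eq n (2 * k - n)
  rw [sign_rect (Nat.sub_add_cancel h), Nat.sub_add_cancel h] at h1
  rw [F_pow_vec, umbral_vanDet_sq, h1, ← vec_smul, mul_smul]
  congr 2
  rw [Algebra.smul_def ((-1 : ℂ) ^ _)]
  simp

theorem F_pow_vec_eq_zero (k n : ℕ) (h : 2 * k < n) : (F 0 ^ n) (vec 1 k) = 0 := by
  -- In the last row the indices are `2k - n - j < 0`.
  rw [F_pow_vec, umbral_vanDet_sq, Matrix.det_eq_zero_of_row_eq_zero ⟨n - 1, by omega⟩]
  · simp [vec]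
  · intro j
    exact pNeg_of_neg (by simp only; omega)

/-! ### Exponentials of locally nilpotent operators -/

section Exp

variable {M : Type} [AddCommGroup M] [Module ℂ M]

theorem opExp_apply {X : Module.End ℂ M} (hX : IsLocallyNilpotent X) {v : M} {B : ℕ}
    (hv : (X ^ B) v = 0) :
    opExp X hX v = ∑ i ∈ Finset.range B, ((i ! : ℂ)⁻¹) • (X ^ i) v := by
  change (∑ᶠ i : ℕ, _) = _
  rw [finsum_eq_sum_of_support_subset (s := Finset.range B)]
  · rfl
  · intro i hi
    rw [Finset.mem_coe, Finset.mem_range]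
    by_contra h
    obtain ⟨d, rfl⟩ := Nat.exists_eq_add_of_le' (not_lt.mp h)
    exact hi (by simp [pow_add, hv])

theorem opExp_smul_apply {Y : Module.End ℂ M} (hY : IsLocallyNilpotent Y) (c : ℂ) {v : M} {B : ℕ}
    (hv : (Y ^ B) v = 0) : opExp (c • Y) (hY.smul c) v =
      Polynomial.aeval Y (PowerSeries.trunc B (PowerSeries.rescale c (PowerSeries.exp ℂ))) v := by
  rw [opExp_apply (B := B) _ (by rw [smul_pow, LinearMap.smul_apply, hv, smul_zero]),
    PowerSeries.trunc_apply, map_sum, LinearMap.sum_apply, Nat.Ico_zero_eq_range]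
  refine Finset.sum_congr rfl fun i _ => ?_
  rw [Polynomial.aeval_monomial, PowerSeries.coeff_rescale, PowerSeries.coeff_exp, smul_pow,
    LinearMap.smul_apply, smul_smul, ← Algebra.smul_def, LinearMap.smul_apply, mul_comm]
  congr 2
  simp

/-- On a vector killed by `Y^B`, both exponentials are truncated polynomials in `Y`, whose product
is `1` modulo `X^B`. -/
theorem opExp_mul_opExp_neg {Y : Module.End ℂ M} (hY : IsLocallyNilpotent Y) (c : ℂ) :
    opExp (c • Y) (hY.smul c) * opExp ((-c) • Y) (hY.smul (-c)) = 1 := by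
  refine LinearMap.ext fun v => ?_
  obtain ⟨B, hB⟩ := hY v
  set f := fun c : ℂ => PowerSeries.rescale c (PowerSeries.exp ℂ) with hf
  have hdvd : Polynomial.X ^ B ∣
      PowerSeries.trunc B (f c) * PowerSeries.trunc B (f (-c)) - 1 := by
    rw [Polynomial.X_pow_dvd_iff]
    intro d hd
    have h1 : f c * f (-c) = 1 := by
      rw [hf, PowerSeries.exp_mul_exp_eq_exp_add, add_neg_cancel, PowerSeries.rescale_zero]
      simp
    rw [Polynomial.coeff_sub, ← Polynomial.coeff_coe, Polynomial.coe_mul,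
      ← PowerSeries.coeff_mul_eq_coeff_trunc_mul_trunc₂ _ _ hd hd, h1, Polynomial.coeff_one, PowerSeries.coeff_one]
    simp
  obtain ⟨g, hg⟩ := hdvd
  -- Polynomials in `Y` commute, so the image of `v` is killed by the same `Y^B` and the same
  -- truncation serves for the outer exponential.
  have hw : (Y ^ B) (Polynomial.aeval Y (PowerSeries.trunc B (f (-c))) v) = 0 := by
    rw [← Module.End.mul_apply, ← Polynomial.aeval_X_pow (R := ℂ) Y, ← map_mul, mul_comm, map_mul,
      Module.End.mul_apply, Polynomial.aeval_X_pow, hB, map_zero]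
  rw [Module.End.mul_apply, opExp_smul_apply hY (-c) hB, opExp_smul_apply hY c hw,
    ← Module.End.mul_apply, ← map_mul, sub_eq_iff_eq_add.mp hg, map_add, map_one, mul_comm,
    map_mul, Polynomial.aeval_X_pow, LinearMap.add_apply, Module.End.mul_apply, hB, map_zero,
    zero_add]

theorem opExp_neg_mul_opExp {Y : Module.End ℂ M} (hY : IsLocallyNilpotent Y) (c : ℂ) :
    opExp ((-c) • Y) (hY.smul (-c)) * opExp (c • Y) (hY.smul c) = 1 := by
  have h := opExp_mul_opExp_neg hY (-c)
  simpa only [neg_neg] using h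

theorem opExp_apply_of_sq {X : Module.End ℂ M} (hX : IsLocallyNilpotent X) {v : M}
    (hv : X (X v) = 0) : opExp X hX v = v + X v := by
  rw [opExp_apply hX (B := 2) (by rw [pow_two, Module.End.mul_apply, hv])]
  simp [Finset.sum_range_succ]

end Exp

/-! ### τ-functions -/

theorem exists_mem_G_expE (c : ℂ) (m : ℤ) :
    ∃ g ∈ G, (g : Module.End ℂ V) = expE c m :=
  ⟨⟨expE c m, expE (-c) m, opExp_mul_opExp_neg (E_locNilp m) c,
    opExp_neg_mul_opExp (E_locNilp m) c⟩, Subgroup.subset_closure ⟨c, m, Or.inl rfl⟩, rfl⟩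

theorem exists_mem_G_expF (c : ℂ) (m : ℤ) :
    ∃ g ∈ G, (g : Module.End ℂ V) = expF c m :=
  ⟨⟨expF c m, expF (-c) m, opExp_mul_opExp_neg (F_locNilp m) c,
    opExp_neg_mul_opExp (F_locNilp m) c⟩, Subgroup.subset_closure ⟨c, m, Or.inr rfl⟩, rfl⟩

theorem polyMode_one (ε s : ℤ) :
    polyMode ε s 1 = intCoeff (formalExp ((ε : ℂ) • eta)) s := by
  change (∑ᶠ i : ℕ, _) = _
  rw [finsum_eq_single _ 0]
  · simp
  · intro i hi
    have h := shiftMode_one (-2 * (ε : ℂ)) hi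
    rw [shiftMode] at h
    rw [LinearMap.comp_apply, h, map_zero]

theorem polyMode_zero_one (ε : ℤ) : polyMode ε 0 1 = 1 := by
  simp [polyMode_one, intCoeff]

theorem polyMode_one_of_neg (ε : ℤ) {s : ℤ} (hs : s < 0) : polyMode ε s 1 = 0 := by
  simp [polyMode_one, intCoeff, not_le.mpr hs]

theorem vec_zero (n : ℤ) : vec 0 n = 0 := by simp [vec]

/-- `e^{(n+1)α} = exp (-F_{1+2n}) exp (E_{-1-2n}) e^{nα}`. -/
theorem expF_expE_vec (n : ℤ) :
    expF (-1) (1 + 2 * n) (expE 1 (-1 - 2 * n) (vec 1 n)) = vec 1 (n + 1) := by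
  -- The modes are chosen so that the power of `z` required is `0`. The two vectors then span a
  -- two-dimensional `sl₂` module, where `exp(E)` gives `v + w` and `exp(-F)` removes `v`.
  have hE1 : E (-1 - 2 * n) (vec 1 n) = vec 1 (n + 1) := by
    rw [E, vertexMode_vec, show -(-1 - 2 * n) - 1 - 2 * 1 * n = 0 by ring, polyMode_zero_one]
  have hE2 : E (-1 - 2 * n) (vec 1 (n + 1)) = 0 := by
    rw [E, vertexMode_vec, polyMode_one_of_neg _ (by linarith), vec_zero]
  have hF1 : F (1 + 2 * n) (vec 1 (n + 1)) = vec 1 n := by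
    rw [F, vertexMode_vec, show -(1 + 2 * n) - 1 - 2 * -1 * (n + 1) = 0 by ring,
      polyMode_zero_one, add_neg_cancel_right]
  have hF2 : F (1 + 2 * n) (vec 1 n) = 0 := by
    rw [F, vertexMode_vec, polyMode_one_of_neg _ (by linarith), vec_zero]
  rw [expE, opExp_apply_of_sq _ (by simp [hE1, hE2]), expF, map_add,
    opExp_apply_of_sq _ (by simp [hF2]), opExp_apply_of_sq _ (by simp [hE1, hF1, hF2])]
  simp [hE1, hF1, hF2]

theorem exists_mem_G_vec (k : ℕ) : ∃ g ∈ G, (g : Module.End ℂ V) (vec 1 0) = vec 1 k := by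
  induction k with
  | zero => exact ⟨1, one_mem _, rfl⟩
  | succ k ih =>
    obtain ⟨g, hg, h⟩ := ih
    obtain ⟨a, ha, ha'⟩ := exists_mem_G_expE 1 (-1 - 2 * k)
    obtain ⟨b, hb, hb'⟩ := exists_mem_G_expF (-1) (1 + 2 * k)
    refine ⟨b * a * g, mul_mem (mul_mem hb ha) hg, ?_⟩
    rw [Units.val_mul, Units.val_mul, Module.End.mul_apply, Module.End.mul_apply, h, ha', hb',
      expF_expE_vec, Nat.cast_succ]

theorem vec_one_zero_ne_zero : vec 1 0 ≠ 0 := by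
  intro h
  -- The functional evaluates at `t = 0` and takes the coefficient of `e^0`; it has value `1` on
  -- this vector.
  have h1 := congrArg (LinearMap.mul' ℂ ℂ ∘ₗ TensorProduct.map
    (MvPolynomial.aeval fun _ : ℕ+ => (0 : ℂ)).toLinearMap
    (Finsupp.lapply (0 : ℤ) ∘ₗ (AddMonoidAlgebra.coeffLinearEquiv ℂ).toLinearMap)) h
  simp [vec] at h1

theorem isTauFunction_of_mem {g : LinearMap.GeneralLinearGroup ℂ V} (hg : g ∈ G) :
    IsTauFunction ((g : Module.End ℂ V) (vec 1 0)) := by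
  refine ⟨fun h => vec_one_zero_ne_zero ?_, g, hg, rfl⟩
  have h1 : (↑g⁻¹ * ↑g : Module.End ℂ V) (vec 1 0) = 0 := by
    rw [Module.End.mul_apply, h, map_zero]
  rwa [Units.inv_mul] at h1

theorem expF_vec (k : ℕ) (γ : ℂ) : expF γ 0 (vec 1 k) =
    ∑ n ∈ Finset.range (2 * k + 1), ((-1 : ℂ) ^ (n * (n + 1) / 2) * γ ^ n) •
      vec (schurRect (2 * k - n) n) ((k : ℤ) - (n : ℤ)) := by
  rw [expF, opExp_apply (B := 2 * k + 1)]
  · refine Finset.sum_congr rfl fun n hn => ?_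
    rw [Finset.mem_range] at hn
    rw [smul_pow, LinearMap.smul_apply, F_pow_vec_eq_schurRect k n (by omega), smul_smul,
      smul_smul]
    congr 1
    have : (n ! : ℂ) ≠ 0 := Nat.cast_ne_zero.mpr n.factorial_ne_zero
    field_simp
  · rw [smul_pow, LinearMap.smul_apply, F_pow_vec_eq_zero k _ (by omega), smul_zero]

theorem isTauFunction_expF_vec (k : ℕ) (γ : ℂ) : IsTauFunction (expF γ 0 (vec 1 k)) := by
  obtain ⟨g, hg, h⟩ := exists_mem_G_vec k
  obtain ⟨a, ha, ha'⟩ := exists_mem_G_expF γ 0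
  have := isTauFunction_of_mem (mul_mem ha hg)
  rwa [Units.val_mul, Module.End.mul_apply, h, ha'] at this

end NLSToda

end

theorem mainTheorem1 (k : ℕ) (γ : ℂ) :
    NLSToda.expF γ 0 (NLSToda.vec 1 k) =
        ∑ n ∈ Finset.range (2 * k + 1),
          ((-1 : ℂ) ^ (n * (n + 1) / 2) * γ ^ n) •
            NLSToda.vec (NLSToda.schurRect (2 * k - n) n) ((k : ℤ) - (n : ℤ)) ∧
      (∀ n : ℕ, n ≤ 2 * k →
        (NLSToda.F 0 ^ n) (NLSToda.vec 1 k) =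
          ((n.factorial : ℂ) * (-1 : ℂ) ^ (n * (n + 1) / 2)) •
            NLSToda.vec (NLSToda.schurRect (2 * k - n) n) ((k : ℤ) - (n : ℤ))) ∧
      (∀ n : ℕ, 2 * k < n → (NLSToda.F 0 ^ n) (NLSToda.vec 1 k) = 0) ∧
      NLSToda.IsTauFunction (NLSToda.expF γ 0 (NLSToda.vec 1 k)) :=
  ⟨NLSToda.expF_vec k γ, NLSToda.F_pow_vec_eq_schurRect k, NLSToda.F_pow_vec_eq_zero k,
    NLSToda.isTauFunction_expF_vec k γ⟩
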